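/- Let $p,q\ge 0$ be integers, $n=p+q$, and let $\mathbb{R}^{p,q}$ be $\mathbb{R}^n$ with the symmetric bilinear form $v\cdot w=\sum_{j=1}^{n}\epsilon_j v_jw_j$, where $\epsilon_j=1$ for $j\le p$ and $\epsilon_j=-1$ for $j>p$. Let $\mathcal{G}^{p,q}$ be its geometric (Clifford) algebra, in which $vw+wv=2\,v\cdot w$ for vectors $v,w$. A blade is an outer product $a_1\wedge\dots\wedge a_k$ of $k\ge 1$ vectors of $\mathbb{R}^{p,q}$, or a real scalar ($k=0$). Two blades $A,B$ are coorthogonal if $AB=BA$ or $AB=-BA$. An orthonormal basis of $\mathbb{R}^{p,q}$ is a basis $v_1,\dots,v_n$ with $v_i\cdot v_j=0$ for $i\ne j$ and $v_i\cdot v_i\in\{1,-1\}$ for all $i$; its basis blades are the geometric products $v_J=v_{j_1}v_{j_2}\cdots v_{j_k}$ for $J=\{j_1<\dots<j_k\}\subseteq\{1,\dots,n\}$, with $v_\emptyset=1$. Theorem. Let $B_1,\dots,B_d$ be finitely many blades in $\mathcal{G}^{p,q}$ such that every nonzero one among them is non-null, that is, $B_k^2\neq 0$ whenever $B_k\ne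 0$ (if $p=0$ or $q=0$, this always holds). Then $B_1,\dots,B_d$ are mutually coorthogonal (every two of them are coorthogonal) if and only if there is one orthonormal basis $v_1,\dots,v_n$ of $\mathbb{R}^{p,q}$ such that every $B_k$ is a real multiple of a basis blade of it: $B_k=c_k\,v_{J_k}$ with $c_k\in\mathbb{R}$ and $J_k\subseteq\{1,\dots,n\}$. -/

import Mathlib

noncomputable section

namespace GeomAlg

/-- The signs `ε_j` of the standard basis of `ℝ^{p,q}`: `1` for the first `p` indices and `-1` for
the remaining `q`. -/
def eps (p q : ℕ) (j : Fin (p + q)) : ℝ := if (j : ℕ) < p then 1 else -1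

/-- The quadratic form `v ↦ ∑ j, ε_j * v_j ^ 2` of signature `(p, q)` on `ℝ^{p+q}`. -/
def form (p q : ℕ) : QuadraticForm ℝ (Fin (p + q) → ℝ) :=
  QuadraticMap.weightedSumSquares ℝ (eps p q)

/-- The geometric algebra `G^{p,q}`, in which a vector `v` has the square `form p q v`. -/
abbrev GA (p q : ℕ) : Type := CliffordAlgebra (form p q)

/-- The outer product `a_1 ∧ … ∧ a_k` of vectors, as an element of `G^{p,q}`, through the canonical
linear isomorphism with the exterior algebra of `ℝ^{p,q}`. For `k = 0` it is `1`. -/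
def outer {p q k : ℕ} (a : Fin k → (Fin (p + q) → ℝ)) : GA p q :=
  (CliffordAlgebra.equivExterior (form p q)).symm (ExteriorAlgebra.ιMulti ℝ k a)

/-- A blade is an outer product of finitely many vectors times a real number. The real factor
matters only for `k = 0`, where it gives all the scalars. -/
def IsBlade {p q : ℕ} (A : GA p q) : Prop :=
  ∃ (k : ℕ) (c : ℝ) (a : Fin k → (Fin (p + q) → ℝ)), A = c • outer a

/-- Two multivectors are coorthogonal if they commute or anticommute. -/
def Coorthogonal {p q : ℕ} (A B : GA p q) : Prop :=
  A * B = B * A ∨ A * B = -(B * A)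

/-- A basis of `ℝ^{p,q}` is orthonormal if its vectors are pairwise orthogonal with squares
`1` or `-1`. -/
def IsOrthonormalBasis {p q : ℕ}
    (v : Module.Basis (Fin (p + q)) ℝ (Fin (p + q) → ℝ)) : Prop :=
  (∀ i j, i ≠ j → (form p q).IsOrtho (v i) (v j)) ∧
    ∀ i, form p q (v i) = 1 ∨ form p q (v i) = -1

/-- The basis blade `v_{j_1} v_{j_2} ⋯ v_{j_k}` (geometric product) for
`J = {j_1 < j_2 < ⋯ < j_k}`. It is `1` for `J = ∅`. -/
def basisBlade {p q : ℕ} (v : Module.Basis (Fin (p + q)) ℝ (Fin (p + q) → ℝ))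
    (J : Finset (Fin (p + q))) : GA p q :=
  ((J.sort (· ≤ ·)).map fun j => CliffordAlgebra.ι (form p q) (v j)).prod

end GeomAlg

end

/-! A nonzero blade is a scalar times a product `P` of `k` orthogonal vectors, and `P * P` is, up to
sign, the product of their squares. So a non-null blade has non-null factors, `P` is invertible, and
`v ↦ (-1)^k P v P⁻¹` is an isometric involution `R` of the vector space: `-1` on the span of the
factors, `+1` on its orthogonal complement (`prod_mul_ι`, `reflections_of_mem`). If two such
products commute up to a scalar, the scalar cancels in conjugation and their involutions commute
(`reflections_comm`). Commuting isometric involutions split the space into mutually orthogonal joint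
eigenspaces; orthogonal bases of these, normalised thanks to nondegeneracy, form one orthonormal
basis (`exists_orthonormal_joint_eigenbasis`). The factors of each blade then span the same subspace
as some basis vectors, and the top outer power of that subspace is a line, so the blade is a
multiple of a basis blade (`exists_prod_eq_smul_basisBlade`). Conversely, distinct vectors of an
orthonormal basis anticommute. -/

namespace GeomAlg

open Module CliffordAlgebra

variable {V : Type*} [AddCommGroup V] [Module ℝ V]

/-! ### Outer and geometric products of orthogonal vectors -/

/-- An alternating map evaluated on vectors in the span of a linearly independent family `b` is a
multiple of its value on `b`. -/
theorem exists_alternatingMap_eq_smul {N : Type*} [AddCommGroup N] [Module ℝ N] {k : ℕ}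
    (f : V [⋀^Fin k]→ₗ[ℝ] N) {a b : Fin k → V} (hb : LinearIndependent ℝ b)
    (hab : ∀ i, a i ∈ Submodule.span ℝ (Set.range b)) : ∃ c : ℝ, f a = c • f b := by
  let e := Basis.span hb
  have he : ∀ i, (e i : V) = b i := fun i => by simp [e, Basis.span_apply]
  have key : f.compLinearMap (Submodule.subtype _) =
      (LinearMap.toSpanSingleton ℝ N (f b)).compAlternatingMap e.det := by
    refine Basis.ext_alternating e fun i h => ?_
    -- An injective index tuple in `Fin k` is a permutation, so both sides differ from their values
    -- on `e` by the same sign.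
    let σ : Equiv.Perm (Fin k) := Equiv.ofBijective i (Finite.injective_iff_bijective.1 h)
    change f.compLinearMap _ (e ∘ σ) = (LinearMap.compAlternatingMap _ e.det) (e ∘ σ)
    rw [AlternatingMap.map_perm, AlternatingMap.map_perm]
    simp [Basis.det_self, he]
  refine ⟨e.det fun i => ⟨a i, hab i⟩, ?_⟩
  simpa using DFunLike.congr_fun key fun i => ⟨a i, hab i⟩

/-- A linear functional vanishing on all factors contracts their product to zero. -/
theorem contractLeft_prod_eq_zero {Q : QuadraticForm ℝ V} (d : Dual ℝ V) (l : List V)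
    (h : ∀ w ∈ l, d w = 0) : contractLeft d (l.map (ι Q)).prod = 0 := by
  induction l with
  | nil => simp
  | cons x l ih =>
    rw [List.map_cons, List.prod_cons, contractLeft_ι_mul, ih fun w hw => h w (by simp [hw]),
      h x (by simp)]
    simp

/-- For pairwise orthogonal vectors the geometric product agrees with the outer product. -/
theorem equivExterior_prod {Q : QuadraticForm ℝ V} (l : List V) (h : l.Pairwise Q.IsOrtho) :
    equivExterior Q (l.map (ι Q)).prod = (l.map (ExteriorAlgebra.ι ℝ)).prod := by
  induction l with
  | nil => simp [equivExterior, changeFormEquiv]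
  | cons x l ih =>
    rw [List.pairwise_cons] at h
    specialize ih h.2
    simp only [equivExterior, changeFormEquiv_apply] at ih ⊢
    -- The two products differ by a contraction with the functional that pairs with `x`; it vanishes
    -- because that functional kills every other factor.
    rw [List.map_cons, List.prod_cons, changeForm_ι_mul, ← changeForm_contractLeft,
      contractLeft_prod_eq_zero, map_zero, sub_zero, ih, List.map_cons, List.prod_cons]
    intro w hw
    have : QuadraticMap.associated (R := ℝ) Q x w = 0 :=
      (QuadraticMap.associated_isOrtho (R := ℝ)).2 (h.1 w hw)
    rw [map_neg, LinearMap.neg_apply, LinearMap.neg_apply, this, neg_zero]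

theorem equivExterior_symm_ιMulti {Q : QuadraticForm ℝ V} {k : ℕ} (w : Fin k → V)
    (h : (List.ofFn w).Pairwise Q.IsOrtho) :
    (equivExterior Q).symm (ExteriorAlgebra.ιMulti ℝ k w) = ((List.ofFn w).map (ι Q)).prod := by
  rw [LinearEquiv.symm_apply_eq, equivExterior_prod _ h, ExteriorAlgebra.ιMulti_apply,
    List.map_ofFn]
  rfl

theorem ι_injective (Q : QuadraticForm ℝ V) : Function.Injective (ι Q) := by
  intro x y h
  have h1 := congrArg (equivExterior Q) h
  simp only [equivExterior, changeFormEquiv_apply, changeForm_ι] at h1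
  exact ExteriorAlgebra.ι_leftInverse.injective h1

theorem prod_mul_ι_of_isOrtho {Q : QuadraticForm ℝ V} (x : V) (l : List V)
    (h : ∀ w ∈ l, Q.IsOrtho x w) :
    (l.map (ι Q)).prod * ι Q x = (-1 : ℝ) ^ l.length • (ι Q x * (l.map (ι Q)).prod) := by
  induction l with
  | nil => simp
  | cons w l ih =>
    rw [List.map_cons, List.prod_cons, mul_assoc, ih fun w hw => h w (by simp [hw]),
      mul_smul_comm, ← mul_assoc, ← mul_assoc,
      ι_mul_ι_comm_of_isOrtho (h w (by simp)), List.length_cons, pow_succ, mul_neg_one, neg_mul,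
      smul_neg, neg_smul, neg_neg]

/-- The square of a product of pairwise orthogonal vectors is the product of their squares,
up to sign. -/
theorem prod_mul_prod_of_pairwise {Q : QuadraticForm ℝ V} (l : List V)
    (h : l.Pairwise Q.IsOrtho) :
    ∃ s : ℝ, s ≠ 0 ∧
      (l.map (ι Q)).prod * (l.map (ι Q)).prod = algebraMap ℝ _ (s * (l.map Q).prod) := by
  induction l with
  | nil => exact ⟨1, one_ne_zero, by simp⟩
  | cons x l ih =>
    rw [List.pairwise_cons] at h
    obtain ⟨s, hs, ih⟩ := ih h.2
    refine ⟨(-1) ^ l.length * s, mul_ne_zero (by simp) hs, ?_⟩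
    rw [List.map_cons, List.prod_cons]
    calc ι Q x * (l.map (ι Q)).prod * (ι Q x * (l.map (ι Q)).prod)
        = ι Q x * ((l.map (ι Q)).prod * ι Q x) * (l.map (ι Q)).prod := by
          simp only [mul_assoc]
      _ = (-1 : ℝ) ^ l.length • ((ι Q x * ι Q x) *
            ((l.map (ι Q)).prod * (l.map (ι Q)).prod)) := by
          rw [prod_mul_ι_of_isOrtho x l h.1]
          simp only [mul_smul_comm, smul_mul_assoc, mul_assoc]
      _ = _ := by
          rw [ih, ι_sq_scalar, ← map_mul, Algebra.smul_def, ← map_mul, List.map_cons,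
            List.prod_cons]
          congr 1; ring

/-! ### Isometries induced by products of non-null vectors -/

/-- The composition of the reflections along the vectors of a list. -/
noncomputable def reflections (Q : QuadraticForm ℝ V) : List V → (V →ₗ[ℝ] V)
  | [] => LinearMap.id
  | x :: l => (LinearMap.id - (Q.polarBilin x).smulRight ((Q x)⁻¹ • x)) ∘ₗ reflections Q l

theorem reflections_cons_apply (Q : QuadraticForm ℝ V) (x : V) (l : List V) (v : V) :
    reflections Q (x :: l) v = reflections Q l v -
      (QuadraticMap.polar Q x (reflections Q l v) * (Q x)⁻¹) • x := by
  simp [reflections, smul_smul]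

/-- Moving `v` leftwards past one factor reflects it and costs a sign. This makes the composed
reflection a signed conjugation by the product; the factors need not be orthogonal. -/
theorem prod_mul_ι {Q : QuadraticForm ℝ V} (l : List V) (h : ∀ w ∈ l, Q w ≠ 0) (v : V) :
    (l.map (ι Q)).prod * ι Q v =
      (-1 : ℝ) ^ l.length • (ι Q (reflections Q l v) * (l.map (ι Q)).prod) := by
  induction l with
  | nil => simp [reflections]
  | cons x l ih =>
    have hx : Q x ≠ 0 := h x (by simp)
    have key : ∀ u : V, ι Q x * ι Q u =
        -(ι Q (u - (QuadraticMap.polar Q x u * (Q x)⁻¹) • x) * ι Q x) := by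
      intro u
      have h1 : ι Q x * ι Q u = algebraMap ℝ _ (QuadraticMap.polar Q x u) - ι Q u * ι Q x :=
        eq_sub_of_add_eq (ι_mul_ι_add_swap x u)
      rw [h1, map_sub, map_smul, sub_mul, smul_mul_assoc, ι_sq_scalar, Algebra.smul_def,
        ← map_mul (algebraMap ℝ (CliffordAlgebra Q)), inv_mul_cancel_right₀ hx]
      abel
    rw [List.map_cons, List.prod_cons, mul_assoc, ih fun w hw => h w (by simp [hw]),
      mul_smul_comm, ← mul_assoc, key, reflections_cons_apply, List.length_cons, pow_succ,
      mul_neg_one, neg_smul, neg_mul, smul_neg, mul_assoc]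

theorem apply_reflections {Q : QuadraticForm ℝ V} (l : List V) (h : ∀ w ∈ l, Q w ≠ 0) (v : V) :
    Q (reflections Q l v) = Q v := by
  induction l with
  | nil => simp [reflections]
  | cons x l ih =>
    have hx : Q x ≠ 0 := h x (by simp)
    rw [reflections_cons_apply, sub_eq_add_neg, ← neg_smul, QuadraticMap.map_add Q,
      QuadraticMap.polar_smul_right, QuadraticMap.map_smul, ih fun w hw => h w (by simp [hw]),
      QuadraticMap.polar_comm Q _ x]
    simp only [smul_eq_mul]
    field_simp
    ring

theorem polar_reflections {Q : QuadraticForm ℝ V} (l : List V) (h : ∀ w ∈ l, Q w ≠ 0)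
    (u v : V) :
    QuadraticMap.polar Q (reflections Q l u) (reflections Q l v) = QuadraticMap.polar Q u v := by
  simp only [QuadraticMap.polar, ← map_add, apply_reflections l h]

/-- Each reflection changes its argument by a multiple of its own vector. Hence a vector sent to its
negative lies in the span of the list. -/
theorem sub_reflections_mem_span (Q : QuadraticForm ℝ V) (l : List V) (v : V) :
    v - reflections Q l v ∈ Submodule.span ℝ {w | w ∈ l} := by
  induction l with
  | nil => simp [reflections]
  | cons x l ih =>
    rw [reflections_cons_apply, sub_sub_eq_add_sub, add_sub_right_comm]
    refine add_mem (Submodule.span_mono (fun w hw => by simp_all) ih)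
      (Submodule.smul_mem _ _ (Submodule.subset_span (by simp)))

theorem reflections_of_isOrtho {Q : QuadraticForm ℝ V} (l : List V) (x : V)
    (h : ∀ w ∈ l, Q.IsOrtho w x) : reflections Q l x = x := by
  induction l with
  | nil => simp [reflections]
  | cons w l ih =>
    rw [reflections_cons_apply, ih fun w hw => h w (by simp [hw]), (h w (by simp)).polar_eq_zero]
    simp

/-- Only the reflection along `x` itself moves `x`; the others fix it, and its negative, by
orthogonality. -/
theorem reflections_of_mem {Q : QuadraticForm ℝ V} (l : List V) (h : l.Pairwise Q.IsOrtho)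
    (hl : ∀ w ∈ l, Q w ≠ 0) (x : V) (hx : x ∈ l) : reflections Q l x = -x := by
  induction l with
  | nil => simp at hx
  | cons w l ih =>
    rw [List.pairwise_cons] at h
    rw [reflections_cons_apply]
    rcases List.mem_cons.1 hx with rfl | hx
    · rw [reflections_of_isOrtho l x fun w hw => (h.1 w hw).symm, QuadraticMap.polar_self,
        smul_mul_assoc, mul_inv_cancel₀ (hl x (by simp))]
      module
    · rw [ih h.2 (fun w hw => hl w (by simp [hw])) hx, QuadraticMap.polar_neg_right,
        (h.1 x hx).polar_eq_zero]
      simp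

/-! ### Orthogonal bases and joint diagonalisation -/

/-- Every subspace has a basis of pairwise orthogonal vectors. -/
theorem exists_pairwise_isOrtho_basis [FiniteDimensional ℝ V] (Q : QuadraticForm ℝ V)
    (W : Submodule ℝ V) :
    ∃ w : Basis (Fin (finrank ℝ W)) ℝ W, ∀ i j, i ≠ j → Q.IsOrtho (w i : V) (w j) := by
  obtain ⟨w, hw⟩ := LinearMap.BilinForm.exists_orthogonal_basis
    (QuadraticForm.associated_isSymm ℝ (Q.comp W.subtype))
  refine ⟨w, fun i j hij => ?_⟩
  have := (QuadraticMap.associated_isOrtho (R := ℝ)).1 (hw hij)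
  simpa [QuadraticMap.isOrtho_def] using this

/-- Commuting isometric involutions of a nondegenerate quadratic space have a common eigenbasis
that is orthonormal. -/
theorem exists_orthonormal_joint_eigenbasis {ι κ : Type*} [Finite ι] (b₀ : Basis ι ℝ V)
    (Q : QuadraticForm ℝ V) (hQ : ∀ x, (∀ y, QuadraticMap.polar Q x y = 0) → x = 0)
    (R : κ → End ℝ V) (hcomm : ∀ k l, R k * R l = R l * R k) (hinv : ∀ k v, R k (R k v) = v)
    (hiso : ∀ k u v, QuadraticMap.polar Q (R k u) (R k v) = QuadraticMap.polar Q u v) :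
    ∃ v : Basis ι ℝ V, (∀ i j, i ≠ j → Q.IsOrtho (v i) (v j)) ∧
      (∀ i, Q (v i) = 1 ∨ Q (v i) = -1) ∧ ∀ k i, R k (v i) = v i ∨ R k (v i) = -v i := by
  classical
  have : FiniteDimensional ℝ V := b₀.finiteDimensional_of_finite
  have hss : ∀ k, (R k).IsSemisimple := fun k => by
    refine Module.End.isSemisimple_of_squarefree_aeval_eq_zero
      (p := (Polynomial.X ^ 2 - Polynomial.C (1 : ℝ))) ?_ ?_
    · exact (Polynomial.separable_X_pow_sub_C _ (by norm_num) one_ne_zero).squarefree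
    · ext v; simp [pow_two, hinv]
  have hmax : ∀ k μ, (R k).maxGenEigenspace μ = (R k).eigenspace μ := fun k μ =>
    (hss k).isFinitelySemisimple.maxGenEigenspace_eq_eigenspace μ
  have htop : ∀ k, ⨆ μ, (R k).maxGenEigenspace μ = ⊤ := fun k => by
    simp only [hmax]
    rw [eq_top_iff]
    intro v _
    have h1 : (1 / 2 : ℝ) • (v + R k v) ∈ ⨆ μ, (R k).eigenspace μ := by
      refine Submodule.mem_iSup_of_mem 1 (Module.End.mem_eigenspace_iff.2 ?_)
      simp [hinv, add_comm]
    have h2 : (1 / 2 : ℝ) • (v - R k v) ∈ ⨆ μ, (R k).eigenspace μ := by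
      refine Submodule.mem_iSup_of_mem (-1) (Module.End.mem_eigenspace_iff.2 ?_)
      simp only [map_smul, map_sub, hinv]
      module
    have h3 := add_mem h1 h2
    have h4 : (1 / 2 : ℝ) • (v + R k v) + (1 / 2 : ℝ) • (v - R k v) = v := by module
    rwa [h4] at h3
  have hc : ∀ i j, Commute (R i) (R j) := fun i j => hcomm i j
  -- All real characters `χ` are allowed as indices; those with a value other than `±1` give the
  -- zero subspace.
  let E : (κ → ℝ) → Submodule ℝ V := fun χ => ⨅ k, (R k).maxGenEigenspace (χ k)
  have hE : ∀ χ v, v ∈ E χ → ∀ k, R k v = χ k • v := fun χ v hv k => by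
    have := (Submodule.mem_iInf _).1 hv k
    rw [hmax] at this
    exact Module.End.mem_eigenspace_iff.1 this
  have hint : DirectSum.IsInternal E :=
    (DirectSum.isInternal_submodule_iff_iSupIndep_and_iSup_eq_top _).2
      ⟨Module.End.independent_iInf_maxGenEigenspace_of_forall_mapsTo R fun i j φ =>
          Module.End.mapsTo_maxGenEigenspace_of_comm (hc j i) φ,
        Module.End.iSup_iInf_maxGenEigenspace_eq_top_of_iSup_maxGenEigenspace_eq_top_of_commute R
          (fun i j _ => hc i j) htop⟩
  have hsq : ∀ χ v, v ∈ E χ → v ≠ 0 → ∀ k, χ k = 1 ∨ χ k = -1 := fun χ v hv hv0 k => by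
    have h1 := hinv k v
    rw [hE χ v hv, map_smul, hE χ v hv, smul_smul] at h1
    have h2 : (χ k * χ k - 1) • v = 0 := by rw [sub_smul, h1, one_smul, sub_self]
    have h3 := (smul_eq_zero.1 h2).resolve_right hv0
    exact mul_self_eq_one_iff.1 (sub_eq_zero.1 h3)
  have hort : ∀ χ χ' u v, χ ≠ χ' → u ∈ E χ → v ∈ E χ' → QuadraticMap.polar Q u v = 0 := by
    intro χ χ' u v hne hu hv
    obtain ⟨k, hk⟩ := Function.ne_iff.1 hne
    by_cases hu0 : u = 0
    · simp [hu0]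
    by_cases hv0 : v = 0
    · simp [hv0]
    have h := hiso k u v
    rw [hE χ u hu, hE χ' v hv, QuadraticMap.polar_smul_left, QuadraticMap.polar_smul_right] at h
    simp only [smul_eq_mul] at h
    -- The two eigenvalues are opposite signs, so invariance under `R k` equates the pairing with
    -- its negative.
    rcases hsq χ u hu hu0 k with h1 | h1 <;> rcases hsq χ' v hv hv0 k with h2 | h2 <;>
      rw [h1, h2] at h hk
    · exact absurd rfl hk
    · linarith
    · linarith
    · exact absurd rfl hk
  choose w hw using fun χ => exists_pairwise_isOrtho_basis Q (E χ)
  let c := hint.collectedBasis w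
  let u := c.reindex (c.indexEquiv b₀)
  have hu : ∀ i, ∃ χ, u i ∈ E χ := fun i =>
    ⟨((c.indexEquiv b₀).symm i).1, by
      rw [Basis.reindex_apply]; exact hint.collectedBasis_mem w _⟩
  have huo : ∀ i j, i ≠ j → Q.IsOrtho (u i) (u j) := by
    intro i j hij
    have hij' := (c.indexEquiv b₀).symm.injective.ne hij
    simp only [u, Basis.reindex_apply]
    generalize (c.indexEquiv b₀).symm i = s at hij'
    generalize (c.indexEquiv b₀).symm j = t at hij'
    by_cases hst : s.1 = t.1
    · obtain ⟨s, x⟩ := s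
      obtain ⟨t, y⟩ := t
      obtain rfl : s = t := hst
      simpa [c, DirectSum.IsInternal.collectedBasis_coe] using
        hw s x y fun h => hij' (by rw [h])
    · exact QuadraticMap.isOrtho_polarBilin.1
        (hort _ _ _ _ hst (hint.collectedBasis_mem w s) (hint.collectedBasis_mem w t))
  -- A null `u i` would be orthogonal to the whole basis, itself included, against nondegeneracy.
  have hu0 : ∀ i, Q (u i) ≠ 0 := by
    intro i hi
    refine u.ne_zero i (hQ _ fun y => ?_)
    have : Q.polarBilin (u i) = 0 := u.ext fun j => by
      by_cases hij : i = j
      · subst hij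
        simp [QuadraticMap.polar_self, hi]
      · simpa using (huo i j hij).polar_eq_zero
    simpa using congrArg (fun f => f y) this
  have hs : ∀ i, √|Q (u i)| ≠ 0 := fun i => by simp [hu0 i]
  refine ⟨u.isUnitSMul (w := fun i => (√|Q (u i)|)⁻¹)
    fun i => (inv_ne_zero (hs i)).isUnit, ?_, ?_, ?_⟩
  · intro i j hij
    simp only [Basis.isUnitSMul_apply]
    refine QuadraticMap.isOrtho_polarBilin.1 ?_
    simp [(huo i j hij).polar_eq_zero]
  · intro i
    rw [Basis.isUnitSMul_apply, QuadraticMap.map_smul, ← mul_inv,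
      Real.mul_self_sqrt (abs_nonneg _), smul_eq_mul]
    rcases abs_choice (Q (u i)) with h | h <;> rw [h]
    · left; exact inv_mul_cancel₀ (hu0 i)
    · right; rw [inv_neg, neg_mul, inv_mul_cancel₀ (hu0 i)]
  · intro k i
    obtain ⟨χ, hχ⟩ := hu i
    rw [Basis.isUnitSMul_apply, map_smul, hE χ _ hχ]
    rcases hsq χ _ hχ (u.ne_zero i) k with h | h <;> simp [h]

/-! ### From coorthogonality to commuting involutions -/

/-- Products of non-null vectors that commute or anticommute have commuting reflections. -/
theorem reflections_comm {Q : QuadraticForm ℝ V} {l m : List V} (hl : ∀ w ∈ l, Q w ≠ 0)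
    (hm : ∀ w ∈ m, Q w ≠ 0) (hlu : IsUnit (l.map (ι Q)).prod) (hmu : IsUnit (m.map (ι Q)).prod)
    {s : ℝ} (h : (l.map (ι Q)).prod * (m.map (ι Q)).prod =
      s • ((m.map (ι Q)).prod * (l.map (ι Q)).prod)) (v : V) :
    reflections Q l (reflections Q m v) = reflections Q m (reflections Q l v) := by
  apply ι_injective Q
  have hlm := hlu.mul hmu
  set P := (l.map (ι Q)).prod with hP
  set P' := (m.map (ι Q)).prod with hP'
  have e1 : P * P' * ι Q v = ((-1 : ℝ) ^ m.length * (-1 : ℝ) ^ l.length) •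
      (ι Q (reflections Q l (reflections Q m v)) * (P * P')) := by
    rw [mul_assoc, hP', prod_mul_ι m hm, mul_smul_comm, ← mul_assoc, hP, prod_mul_ι l hl,
      smul_mul_assoc, smul_smul, mul_assoc]
  have e2 : P' * P * ι Q v = ((-1 : ℝ) ^ m.length * (-1 : ℝ) ^ l.length) •
      (ι Q (reflections Q m (reflections Q l v)) * (P' * P)) := by
    rw [mul_assoc, hP, prod_mul_ι l hl, mul_smul_comm, ← mul_assoc, hP', prod_mul_ι m hm,
      smul_mul_assoc, smul_smul, mul_assoc, mul_comm ((-1 : ℝ) ^ l.length)]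
  -- The factor `s` is absorbed back into `P * P'`, so `e1` and `e3` end in the same unit, which
  -- cancels.
  have e3 : P * P' * ι Q v = ((-1 : ℝ) ^ m.length * (-1 : ℝ) ^ l.length) •
      (ι Q (reflections Q m (reflections Q l v)) * (P * P')) := by
    rw [h, smul_mul_assoc, e2, mul_smul_comm, smul_comm]
  rw [e1] at e3
  exact hlm.mul_right_cancel (smul_right_injective _ (by simp) e3)

/-- Conjugating twice is conjugating by the square, a nonzero scalar and hence central; the two
signs multiply to `1`. -/
theorem reflections_reflections {Q : QuadraticForm ℝ V} {l : List V} (hl : ∀ w ∈ l, Q w ≠ 0)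
    {r : ℝ} (hr : r ≠ 0) (h : (l.map (ι Q)).prod * (l.map (ι Q)).prod = algebraMap ℝ _ r)
    (v : V) : reflections Q l (reflections Q l v) = v := by
  apply ι_injective Q
  have e1 := congrArg ((l.map (ι Q)).prod * ·) (prod_mul_ι l hl v)
  simp only [mul_smul_comm] at e1
  rw [← mul_assoc, h, ← mul_assoc, prod_mul_ι l hl, smul_mul_assoc, smul_smul, mul_assoc, h,
    ← mul_pow, neg_one_mul, neg_neg, one_pow, one_smul, ← Algebra.commutes, ← Algebra.smul_def,
    ← Algebra.smul_def] at e1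
  exact (smul_right_injective _ hr e1).symm

/-! ### Blades in signature `(p, q)` -/

theorem polar_form {p q : ℕ} (x y : Fin (p + q) → ℝ) :
    QuadraticMap.polar (form p q) x y = ∑ j, 2 * (eps p q j * (x j * y j)) := by
  simp only [QuadraticMap.polar, form, QuadraticMap.weightedSumSquares_apply, smul_eq_mul,
    Pi.add_apply, ← Finset.sum_sub_distrib]
  exact Finset.sum_congr rfl fun j _ => by ring

theorem form_nondegenerate {p q : ℕ} (x : Fin (p + q) → ℝ)
    (h : ∀ y, QuadraticMap.polar (form p q) x y = 0) : x = 0 := by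
  funext j
  have hj := h (Pi.single j 1)
  rw [polar_form, Finset.sum_eq_single j (fun i _ hij => by simp [hij]) (by simp)] at hj
  have he : eps p q j ≠ 0 := by unfold eps; split_ifs <;> norm_num
  simpa [he] using hj

/-- A blade is a multiple of a geometric product of orthogonal vectors. -/
theorem IsBlade.exists_eq_smul_prod {p q : ℕ} {A : GA p q} (hA : IsBlade A) (h0 : A ≠ 0) :
    ∃ (c : ℝ) (l : List (Fin (p + q) → ℝ)), l.Pairwise (form p q).IsOrtho ∧
      A = c • (l.map (ι (form p q))).prod := by
  obtain ⟨k, c, a, rfl⟩ := hA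
  have ha : LinearIndependent ℝ a := by
    by_contra hna
    apply h0
    rw [outer, (ExteriorAlgebra.ιMulti ℝ k).map_linearDependent a hna, map_zero, smul_zero]
  obtain ⟨w, hw⟩ := exists_pairwise_isOrtho_basis (form p q) (Submodule.span ℝ (Set.range a))
  have hk : finrank ℝ (Submodule.span ℝ (Set.range a)) = k := by
    simpa using finrank_span_eq_card ha
  let b : Fin k → (Fin (p + q) → ℝ) := fun i => w (Fin.cast hk.symm i)
  have hb : LinearIndependent ℝ b := (w.linearIndependent.map' _ (Submodule.ker_subtype _)).comp _
    (Fin.cast_injective hk.symm)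
  have hspan : Submodule.span ℝ (Set.range b) = Submodule.span ℝ (Set.range a) := by
    have h1 : Set.range b = Submodule.subtype _ '' Set.range w := by
      rw [← Set.range_comp]
      exact (finCongr hk.symm).surjective.range_comp (Submodule.subtype _ ∘ w)
    rw [h1, Submodule.span_image, w.span_eq, Submodule.map_top, Submodule.range_subtype]
  obtain ⟨s, hs⟩ := exists_alternatingMap_eq_smul (ExteriorAlgebra.ιMulti ℝ k) (a := a) hb
    fun i => by rw [hspan]; exact Submodule.subset_span ⟨i, rfl⟩
  have hpair : (List.ofFn b).Pairwise (form p q).IsOrtho :=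
    List.pairwise_ofFn.2 fun i j hij => hw _ _ ((Fin.cast_injective hk.symm).ne hij.ne)
  refine ⟨c * s, List.ofFn b, hpair, ?_⟩
  rw [outer, hs, map_smul, equivExterior_symm_ιMulti b hpair, smul_smul]

/-- A nonzero blade with nonzero square is a multiple of a geometric product of orthogonal
non-null vectors. -/
theorem IsBlade.exists_eq_smul_prod_of_sq_ne_zero {p q : ℕ} {A : GA p q} (hA : IsBlade A)
    (h0 : A * A ≠ 0) :
    ∃ (c : ℝ) (l : List (Fin (p + q) → ℝ)), c ≠ 0 ∧ l.Pairwise (form p q).IsOrtho ∧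
      (∀ w ∈ l, form p q w ≠ 0) ∧ A = c • (l.map (ι (form p q))).prod := by
  obtain ⟨c, l, hl, rfl⟩ := hA.exists_eq_smul_prod fun h => h0 (by simp [h])
  obtain ⟨s, hs, h⟩ := prod_mul_prod_of_pairwise l hl
  refine ⟨c, l, fun hc => h0 (by simp [hc]), hl, fun w hw hw0 => h0 ?_, rfl⟩
  have : (l.map (form p q)).prod = 0 := List.prod_eq_zero (List.mem_map.2 ⟨w, hw, hw0⟩)
  rw [smul_mul_smul_comm, h, this]
  simp

/-- The geometric product of a list of orthogonal non-null vectors whose reflections are diagonal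
in an orthonormal basis is a multiple of a basis blade. -/
theorem exists_prod_eq_smul_basisBlade {p q : ℕ}
    {v : Basis (Fin (p + q)) ℝ (Fin (p + q) → ℝ)} (hv : IsOrthonormalBasis v)
    (l : List (Fin (p + q) → ℝ)) (hl : l.Pairwise (form p q).IsOrtho)
    (hl0 : ∀ w ∈ l, form p q w ≠ 0) (hP : (l.map (ι (form p q))).prod ≠ 0)
    (h : ∀ i, reflections (form p q) l (v i) = v i ∨ reflections (form p q) l (v i) = -v i) :
    ∃ (c : ℝ) (J : Finset (Fin (p + q))),
      (l.map (ι (form p q))).prod = c • basisBlade v J := by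
  classical
  let J := Finset.univ.filter fun i => reflections (form p q) l (v i) = -v i
  -- Both spans are the `-1` eigenspace: a factor `w` is negated, so its coordinates at fixed basis
  -- vectors vanish, while a negated `v i` satisfies `2 v i = v i - R (v i)`, which lies in the span
  -- of `l`.
  have hspan : Submodule.span ℝ {w | w ∈ l} = Submodule.span ℝ (v '' J) := by
    apply le_antisymm
    · rw [Submodule.span_le]
      intro w hw
      rw [SetLike.mem_coe, v.mem_span_image]
      intro i hi
      have h1 := reflections_of_mem l hl hl0 w hw
      have h2 : v.repr (reflections (form p q) l w) i =
          v.repr w i * v.repr (reflections (form p q) l (v i)) i := by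
        have : (v.coord i).comp (reflections (form p q) l) =
            (v.repr (reflections (form p q) l (v i)) i) • v.coord i := v.ext fun j => by
          by_cases hij : j = i
          · subst hij; simp
          · rcases h j with hj | hj <;> simp [hj, hij]
        simpa [mul_comm] using congrArg (fun f => f w) this
      rcases h i with hi' | hi'
      · rw [h1, hi'] at h2
        simp only [map_neg, Finsupp.neg_apply, Basis.repr_self, Finsupp.single_eq_same,
          mul_one] at h2
        exact absurd (by linarith) (Finsupp.mem_support_iff.1 hi)
      · simpa [J] using hi'
    · rw [Submodule.span_le]
      rintro _ ⟨i, hi, rfl⟩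
      have hi' : reflections (form p q) l (v i) = -v i := by simpa [J] using hi
      have := sub_reflections_mem_span (form p q) l (v i)
      rw [hi', sub_neg_eq_add, ← two_smul ℝ] at this
      exact (Submodule.smul_mem_iff _ two_ne_zero).1 this
  have hrange : Set.range l.get = {w | w ∈ l} := by ext; simp [List.mem_iff_get]
  have hfn : ((equivExterior (form p q)).symm (ExteriorAlgebra.ιMulti ℝ l.length l.get)) =
      (l.map (ι (form p q))).prod := by
    rw [equivExterior_symm_ιMulti _ (by rwa [List.ofFn_get]), List.ofFn_get]
  have hli : LinearIndependent ℝ l.get := by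
    by_contra hna
    apply hP
    rw [← hfn, (ExteriorAlgebra.ιMulti ℝ _).map_linearDependent _ hna, map_zero]
  have hJ : J.card = l.length := by
    have h1 := finrank_span_eq_card hli
    have h2 := finrank_span_eq_card
      (v.linearIndependent.comp _ (Subtype.val_injective (p := (· ∈ J))))
    have h3 : Set.range (v ∘ ((↑) : J → _)) = v '' J := by
      rw [Set.range_comp]; simp
    rw [hrange, hspan] at h1
    rw [h3, h1] at h2
    simpa using h2.symm
  let b : Fin l.length → (Fin (p + q) → ℝ) := v ∘ J.orderEmbOfFin hJ
  have hb : LinearIndependent ℝ b := v.linearIndependent.comp _ (J.orderEmbOfFin hJ).injective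
  have hbr : Set.range b = v '' J := by rw [Set.range_comp, Finset.range_orderEmbOfFin]
  obtain ⟨c, hc⟩ := exists_alternatingMap_eq_smul (ExteriorAlgebra.ιMulti ℝ l.length)
    (a := l.get) hb fun i => by
      rw [hbr, ← hspan]; exact Submodule.subset_span (List.get_mem _ _)
  refine ⟨c, J, ?_⟩
  rw [← hfn, hc, map_smul, equivExterior_symm_ιMulti]
  · congr 1
    have : J.sort (· ≤ ·) = List.ofFn (J.orderEmbOfFin hJ) := by
      rw [← Finset.listMap_orderEmbOfFin_finRange J hJ, List.ofFn_eq_map]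
    rw [basisBlade, this, List.map_ofFn, List.map_ofFn]
    rfl
  · rw [List.pairwise_ofFn]
    exact fun i j hij => hv.1 _ _ ((J.orderEmbOfFin hJ).injective.ne hij.ne)

/-! ### Coorthogonality of basis blades -/

/-- Vectors of an orthonormal basis commute up to sign, hence so do their products. -/
theorem prod_mul_prod_eq_or {p q : ℕ}
    {v : Basis (Fin (p + q)) ℝ (Fin (p + q) → ℝ)} (hv : IsOrthonormalBasis v)
    (s t : List (Fin (p + q))) :
    Coorthogonal ((s.map fun j => ι (form p q) (v j)).prod)
      ((t.map fun j => ι (form p q) (v j)).prod) := by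
  have mul {A B C : GA p q} (h1 : Coorthogonal A C) (h2 : Coorthogonal B C) :
      Coorthogonal (A * B) C := by
    unfold Coorthogonal at *
    rcases h1 with h1 | h1 <;> rcases h2 with h2 | h2
    · left; rw [mul_assoc, h2, ← mul_assoc, h1, mul_assoc]
    · right; rw [mul_assoc, h2, mul_neg, ← mul_assoc, h1, mul_assoc]
    · right; rw [mul_assoc, h2, ← mul_assoc, h1, neg_mul, mul_assoc]
    · left; rw [mul_assoc, h2, mul_neg, ← mul_assoc, h1, neg_mul, neg_neg, mul_assoc]
  have symm {A B : GA p q} (h : Coorthogonal A B) : Coorthogonal B A := by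
    rcases h with h | h
    · exact .inl h.symm
    · exact .inr (by rw [h, neg_neg])
  have one (A : GA p q) : Coorthogonal 1 A := .inl (by simp)
  have base : ∀ i j, Coorthogonal (ι (form p q) (v i)) (ι (form p q) (v j)) := fun i j => by
    by_cases hij : i = j
    · exact .inl (by rw [hij])
    · exact .inr (ι_mul_ι_comm_of_isOrtho (hv.1 i j hij))
  induction s with
  | nil => exact one _
  | cons i s ih =>
    refine mul ?_ ih
    clear ih
    induction t with
    | nil => exact symm (one _)
    | cons j t ih => exact symm (mul (base j i) (symm ih))

theorem Coorthogonal.smul_smul {p q : ℕ} {A B : GA p q} (h : Coorthogonal A B) (a b : ℝ) :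
    Coorthogonal (a • A) (b • B) := by
  rcases h with h | h
  · left; rw [smul_mul_smul_comm, smul_mul_smul_comm, h, mul_comm a]
  · right; rw [smul_mul_smul_comm, smul_mul_smul_comm, h, mul_comm a, smul_neg]

end GeomAlg

/-! ### The equivalence -/

theorem mainTheorem3 (p q d : ℕ) (B : Fin d → GeomAlg.GA p q)
    (hB : ∀ k, GeomAlg.IsBlade (B k))
    (hnull : ∀ k, B k ≠ 0 → B k * B k ≠ 0) :
    (∀ k l, GeomAlg.Coorthogonal (B k) (B l)) ↔
      ∃ v : Module.Basis (Fin (p + q)) ℝ (Fin (p + q) → ℝ),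
        GeomAlg.IsOrthonormalBasis v ∧
          ∀ k, ∃ (c : ℝ) (J : Finset (Fin (p + q))), B k = c • GeomAlg.basisBlade v J := by
  open GeomAlg in
  constructor
  · intro hco
    -- A zero blade is written as `0` times the empty product; its involution is the identity, and
    -- `1` commutes with everything, although the zero blade itself says nothing about any list.
    have hex : ∀ k, ∃ (c : ℝ) (l : List (Fin (p + q) → ℝ)), (c = 0 → l = []) ∧
        l.Pairwise (form p q).IsOrtho ∧ (∀ w ∈ l, form p q w ≠ 0) ∧
        B k = c • (l.map (CliffordAlgebra.ι (form p q))).prod := by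
      intro k
      by_cases hk : B k = 0
      · exact ⟨0, [], by simp [hk]⟩
      · obtain ⟨c, l, hc, h⟩ := (hB k).exists_eq_smul_prod_of_sq_ne_zero (hnull k hk)
        exact ⟨c, l, fun h0 => absurd h0 hc, h⟩
    choose c l hc hl hl0 hBl using hex
    have hsq : ∀ k, ∃ r : ℝ, r ≠ 0 ∧ ((l k).map (CliffordAlgebra.ι (form p q))).prod *
        ((l k).map (CliffordAlgebra.ι (form p q))).prod = algebraMap ℝ _ r := fun k => by
      obtain ⟨s, hs, h⟩ := prod_mul_prod_of_pairwise (l k) (hl k)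
      refine ⟨_, mul_ne_zero hs (List.prod_ne_zero fun h0 => ?_), h⟩
      obtain ⟨w, hw, hw0⟩ := List.mem_map.1 h0
      exact hl0 k w hw hw0
    have hunit : ∀ k, IsUnit ((l k).map (CliffordAlgebra.ι (form p q))).prod := fun k => by
      obtain ⟨r, hr, h⟩ := hsq k
      have hu := (isUnit_iff_ne_zero.2 hr).map (algebraMap ℝ (GA p q))
      rw [← h] at hu
      exact ((Commute.refl _).isUnit_mul_iff.1 hu).1
    have hcomm : ∀ k m, ∃ s : ℝ, ((l k).map (CliffordAlgebra.ι (form p q))).prod *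
        ((l m).map (CliffordAlgebra.ι (form p q))).prod =
        s • (((l m).map (CliffordAlgebra.ι (form p q))).prod *
          ((l k).map (CliffordAlgebra.ι (form p q))).prod) := fun k m => by
      by_cases hk : c k = 0
      · exact ⟨1, by simp [hc k hk]⟩
      by_cases hm : c m = 0
      · exact ⟨1, by simp [hc m hm]⟩
      have hkm := (hco k m)
      rw [Coorthogonal, hBl k, hBl m, smul_mul_smul_comm, smul_mul_smul_comm,
        mul_comm (c m), ← smul_neg] at hkm
      have hinj := smul_right_injective (GA p q) (mul_ne_zero hk hm)
      rcases hkm with h | h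
      · exact ⟨1, by rw [one_smul]; exact hinj h⟩
      · exact ⟨-1, by rw [neg_one_smul]; exact hinj h⟩
    obtain ⟨v, hv, hv', hR⟩ := exists_orthonormal_joint_eigenbasis (Pi.basisFun ℝ (Fin (p + q)))
      (form p q) form_nondegenerate (fun k => reflections (form p q) (l k))
      (fun k m => LinearMap.ext fun x =>
        (hcomm k m).elim fun _ h => reflections_comm (hl0 k) (hl0 m) (hunit k) (hunit m) h x)
      (fun k x => (hsq k).elim fun _ h => reflections_reflections (hl0 k) h.1 h.2 x)
      (fun k x y => polar_reflections (l k) (hl0 k) x y)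
    refine ⟨v, ⟨hv, hv'⟩, fun k => ?_⟩
    have : Nontrivial (GA p q) := (CliffordAlgebra.equivExterior _).symm.injective.nontrivial
    obtain ⟨s, J, h⟩ := exists_prod_eq_smul_basisBlade ⟨hv, hv'⟩ (l k) (hl k) (hl0 k)
      (hunit k).ne_zero (hR k)
    exact ⟨c k * s, J, by rw [hBl k, h, smul_smul]⟩
  · rintro ⟨v, hv, h⟩ k l
    obtain ⟨c, J, hJ⟩ := h k
    obtain ⟨c', J', hJ'⟩ := h l
    rw [hJ, hJ']
    exact (prod_mul_prod_eq_or hv _ _).smul_smul _ _
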